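/- Call a real $n\times n$ matrix with nonnegative entries doubly substochastic if each of its row sums and each of its column sums is at most $1$. For an $n\times n$ matrix $A=[a_{ij}]$ let $\sigma(A)=\sum_{i,j=1}^n a_{ij}$, and let $\mathrm{per}(A)=\sum_{\pi\in S_n}\prod_{i=1}^n a_{i\pi(i)}$ be its permanent. Let $0\le s\le n$ be real, and assume that either $n$ is even, or $n$ is odd and $s\le n-1$. Let $e$ be the greatest even integer less than or equal to $s$. Then $$\max\{\mathrm{per}(I-A) : A \text{ is an } n\times n \text{ doubly substochastic matrix with } \sigma(A)=s\}=2^{e/2}\left[1+\left(\frac{s-e}{2}\right)^2\right].$$ Moreover, with $M_2=\begin{pmatrix}0&1\\1&0\end{pmatrix}$, the maximum is attained at the $n\times n$ block-diagonal matrix $$\underbrace{M_2\oplus\cdots\oplus M_2}_{e/2}\oplus\frac{s-e}{2}M_2\oplus \mathbf 0_{n-e-2},$$ which is doubly substochastic with entry sum $s$. (If $n-e<2$, then $s=e$; in this case the last two summands are replaced by $\mathbf 0_{n-e}$, which is absent if $e=n$.) -/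

import Mathlib

/-- A real square matrix is doubly substochastic if its entries are nonnegative and each of its
row sums and column sums is at most one. -/
structure IsDoublySubstochastic {n : ℕ} (A : Matrix (Fin n) (Fin n) ℝ) : Prop where
  nonneg : ∀ i j, 0 ≤ A i j
  row_sum_le : ∀ i, ∑ j, A i j ≤ 1
  col_sum_le : ∀ j, ∑ i, A i j ≤ 1

/-- The sum `σ(A)` of all entries of a matrix. -/
def entrySum {n : ℕ} (A : Matrix (Fin n) (Fin n) ℝ) : ℝ :=
  ∑ i, ∑ j, A i j

/-- The set `ω_n^s` of `n × n` doubly substochastic matrices whose entries sum to `s`. -/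
def omegaSet (n : ℕ) (s : ℝ) : Set (Matrix (Fin n) (Fin n) ℝ) :=
  {A | IsDoublySubstochastic A ∧ entrySum A = s}

/-- The matrix `M₂`. -/
def swapMatrix : Matrix (Fin 2) (Fin 2) ℝ :=
  !![0, 1; 1, 0]

/-- The `n × n` upper left corner of the infinite block-diagonal matrix
`c 0 • M₂ ⊕ c 1 • M₂ ⊕ c 2 • M₂ ⊕ ⋯`: the indices `2 k` and `2 k + 1` form the `k`-th block. If `n`
is odd, the last index is alone in its block, and its row and column are zero. -/
def swapBlocks (n : ℕ) (c : ℕ → ℝ) : Matrix (Fin n) (Fin n) ℝ :=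
  Matrix.of fun i j =>
    if (i : ℕ) / 2 = (j : ℕ) / 2 then
      c ((i : ℕ) / 2) * swapMatrix (Fin.ofNat 2 (i : ℕ)) (Fin.ofNat 2 (j : ℕ))
    else 0

/-- The `n × n` matrix `M₂ ⊕ ⋯ ⊕ M₂ ⊕ ((s - e) / 2) • M₂ ⊕ 0`, with `e / 2` copies of `M₂` before
the scaled one, for an even number `e`. -/
noncomputable def extremalMatrix (n : ℕ) (s : ℝ) (e : ℕ) : Matrix (Fin n) (Fin n) ℝ :=
  swapBlocks n fun k => if k < e / 2 then 1 else if k = e / 2 then (s - (e : ℝ)) / 2 else 0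

/-! With r_i the row sums of A, row i of I - A is a convex combination of the vectors e_i - r_i e_j.
By multilinearity (`permanent_of_rows_sum`), per(I - A) is an average of permanents per(I - D F),
where D = diag(r) and F is the 0/1 matrix of a self-map f, so it suffices to bound these. A cycle of
f splits off as a diagonal block with permanent 1 + ∏(-r_i), or 1 - r_i at a fixed point; what
remains is I - B with B smaller, and induction applies.

The two bounds combine because G = `floorGrowth` satisfies G(a) G(b) ≤ G(a + b)
(`floorGrowth_mul_le`), whence per(I - A) ≤ G(σ(A)/2). If s/2 = q + t with q an integer and 0 ≤ t <
1, then G(s/2) = 2^q (1 + t²), which is the value at the block matrix. -/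

/-- The function `t ↦ 2 ^ ⌊t⌋ * (1 + {t} ^ 2)` for nonnegative `t`. -/
noncomputable def floorGrowth (t : ℝ) : ℝ :=
  2 ^ ⌊t⌋₊ * (1 + (t - ⌊t⌋₊) ^ 2)

lemma one_le_floorGrowth (t : ℝ) : 1 ≤ floorGrowth t := by
  unfold floorGrowth
  have h₁ : (1 : ℝ) ≤ 2 ^ ⌊t⌋₊ := one_le_pow₀ (by norm_num)
  nlinarith [sq_nonneg (t - ⌊t⌋₊)]

lemma floorGrowth_eq {m : ℕ} {t : ℝ} (h₁ : (m : ℝ) ≤ t) (h₂ : t < m + 1) :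
    floorGrowth t = 2 ^ m * (1 + (t - m) ^ 2) := by
  have h : ⌊t⌋₊ = m := (Nat.floor_eq_iff (m.cast_nonneg.trans h₁)).2 ⟨h₁, h₂⟩
  rw [floorGrowth, h]

lemma one_add_sq_le_floorGrowth {t : ℝ} (h₀ : 0 ≤ t) (h₁ : t ≤ 1) :
    1 + t ^ 2 ≤ floorGrowth t := by
  rcases h₁.lt_or_eq with h | rfl
  · rw [floorGrowth_eq (m := 0) (by simpa) (by simpa)]
    simp
  · rw [floorGrowth_eq (m := 1) (by simp) (by norm_num)]
    norm_num

/-- Integer parts add, so only the fractional parts x, y matter, with or without a carry. Without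
one, the gap is 2xy - x²y² ≥ 0. -/
lemma floorGrowth_mul_le {a b : ℝ} (ha : 0 ≤ a) (hb : 0 ≤ b) :
    floorGrowth a * floorGrowth b ≤ floorGrowth (a + b) := by
  obtain ⟨m, x, hx₀, hx₁, rfl⟩ : ∃ (m : ℕ) (x : ℝ), 0 ≤ x ∧ x < 1 ∧ a = m + x :=
    ⟨⌊a⌋₊, a - ⌊a⌋₊, sub_nonneg.2 (Nat.floor_le ha), by linarith [Nat.lt_floor_add_one a], by ring⟩
  obtain ⟨k, y, hy₀, hy₁, rfl⟩ : ∃ (m : ℕ) (x : ℝ), 0 ≤ x ∧ x < 1 ∧ b = m + x :=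
    ⟨⌊b⌋₊, b - ⌊b⌋₊, sub_nonneg.2 (Nat.floor_le hb), by linarith [Nat.lt_floor_add_one b], by ring⟩
  rw [floorGrowth_eq (m := m) (by linarith) (by linarith),
    floorGrowth_eq (m := k) (by linarith) (by linarith)]
  have hxy := mul_nonneg hx₀ hy₀
  have hpow : (0 : ℝ) < 2 ^ (m + k) := by positivity
  rcases lt_or_ge (x + y) 1 with h | h
  · rw [floorGrowth_eq (m := m + k) (by push_cast; linarith) (by push_cast; linarith)]
    have key : (1 + x ^ 2) * (1 + y ^ 2) ≤ 1 + (x + y) ^ 2 := by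
      have : x * y ≤ 1 := mul_le_one₀ hx₁.le hy₀ hy₁.le
      nlinarith
    calc _ = 2 ^ (m + k) * ((1 + x ^ 2) * (1 + y ^ 2)) := by ring
      _ ≤ 2 ^ (m + k) * (1 + (x + y) ^ 2) := mul_le_mul_of_nonneg_left key hpow.le
      _ = _ := by push_cast; ring
  · rw [floorGrowth_eq (m := m + k + 1) (by push_cast; linarith) (by push_cast; linarith)]
    have key : (1 + x ^ 2) * (1 + y ^ 2) ≤ 2 * (1 + (x + y - 1) ^ 2) := by
      have h₁ : 0 ≤ (1 - x) * (1 - y) := mul_nonneg (by linarith) (by linarith)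
      -- With u = 1 - x and v = 1 - y, the gap in `key` is exactly uv(2u + 2v - uv).
      have h₂ : 0 ≤ (1 - x) * (1 - y) * (2 * (1 - x) + 2 * (1 - y) - (1 - x) * (1 - y)) :=
        mul_nonneg h₁ (by nlinarith)
      nlinarith
    calc _ = 2 ^ (m + k) * ((1 + x ^ 2) * (1 + y ^ 2)) := by ring
      _ ≤ 2 ^ (m + k) * (2 * (1 + (x + y - 1) ^ 2)) := mul_le_mul_of_nonneg_left key hpow.le
      _ = _ := by push_cast; ring

lemma floorGrowth_mono {a b : ℝ} (ha : 0 ≤ a) (hab : a ≤ b) :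
    floorGrowth a ≤ floorGrowth b :=
  calc floorGrowth a ≤ floorGrowth a * floorGrowth (b - a) :=
        le_mul_of_one_le_right (zero_le_one.trans (one_le_floorGrowth a)) (one_le_floorGrowth _)
    _ ≤ floorGrowth (a + (b - a)) := floorGrowth_mul_le ha (sub_nonneg.2 hab)
    _ = floorGrowth b := by rw [add_sub_cancel]

/-! ### Permanents: multilinearity and block factorization -/

namespace Matrix

open Equiv Finset

section CommSemiring

variable {m n R : Type*} [Fintype m] [DecidableEq n] [Fintype n] [CommSemiring R]

lemma permanent_apply_row (M : Matrix n n R) :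
    M.permanent = ∑ σ : Perm n, ∏ i, M i (σ i) := by
  rw [← permanent_transpose]
  rfl

/-- The permanent is multilinear in the rows. -/
lemma permanent_of_rows_sum (p : n → m → R) (N : n → m → n → R) :
    (of fun i k ↦ ∑ j, p i j * N i j k : Matrix n n R).permanent =
      ∑ f : n → m, (∏ i, p i (f i)) * (of fun i k ↦ N i (f i) k : Matrix n n R).permanent := by
  simp only [permanent_apply_row, of_apply, prod_univ_sum, Fintype.piFinset_univ, mul_sum,
    prod_mul_distrib]
  rw [sum_comm]

variable [DecidableEq m]

lemma permanent_submatrix_equiv_self (e : n ≃ m) (A : Matrix m m R) :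
    (A.submatrix e e).permanent = A.permanent := by
  unfold permanent
  refine Fintype.sum_equiv (Equiv.permCongr e) _ _ fun σ ↦ ?_
  refine Fintype.prod_equiv e _ _ fun i ↦ ?_
  simp

/-- A permutation contributes only if it preserves the first summand, and then it is a pair of
permutations. -/
lemma permanent_fromBlocks_zero₂₁ (A : Matrix m m R) (B : Matrix m n R) (D : Matrix n n R) :
    (fromBlocks A B 0 D).permanent = A.permanent * D.permanent := by
  classical
  unfold permanent
  symm
  rw [sum_mul_sum, ← sum_product', univ_product_univ]
  refine sum_bij_ne_zero (fun σ _ _ ↦ Perm.sumCongrHom m n σ) (fun _ _ _ ↦ mem_univ _) ?_ ?_ ?_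
  · intro σ _ _ τ _ _ h
    exact Perm.sumCongrHom_injective h
  · intro σ _ hσ
    have hmaps : Set.MapsTo σ (Set.range Sum.inl) (Set.range Sum.inl) := by
      rintro _ ⟨a, rfl⟩
      rcases hx : σ (Sum.inl a) with a₂ | b
      · exact ⟨a₂, rfl⟩
      · exact absurd (prod_eq_zero (mem_univ (Sum.inl a)) (by simp [hx])) hσ
    obtain ⟨τ, rfl⟩ := Perm.mem_sumCongrHom_range_of_perm_mapsTo_inl hmaps
    refine ⟨τ, mem_univ _, ?_, rfl⟩
    simpa [Fintype.prod_sum_type] using hσ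
  · intro σ _ _
    simp [Fintype.prod_sum_type]

lemma permanent_fromBlocks_zero₁₂ (A : Matrix m m R) (C : Matrix n m R) (D : Matrix n n R) :
    (fromBlocks A 0 C D).permanent = A.permanent * D.permanent := by
  rw [← permanent_transpose, fromBlocks_transpose, transpose_zero, permanent_fromBlocks_zero₂₁,
    permanent_transpose, permanent_transpose]

/-- If the rows indexed by `p` vanish outside of the columns indexed by `p`, the permanent is the
product of the permanents of the two diagonal blocks. -/
lemma permanent_eq_mul_of_rows_zero (p : n → Prop) [DecidablePred p] (M : Matrix n n R)
    (h : ∀ i j, p i → ¬ p j → M i j = 0) :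
    M.permanent = (M.submatrix (Subtype.val : {i // p i} → n) Subtype.val).permanent *
      (M.submatrix (Subtype.val : {i // ¬ p i} → n) Subtype.val).permanent := by
  rw [← permanent_submatrix_equiv_self (Equiv.sumCompl p) M,
    ← permanent_fromBlocks_zero₁₂ _ (M.submatrix (Subtype.val : {i // ¬ p i} → n)
      (Subtype.val : {i // p i} → n))]
  congr 1
  ext (i | i) (j | j) <;> simp
  exact h _ _ i.2 j.2

end CommSemiring

/-! ### Permanents attached to self-maps -/

section Real

variable {n : Type*} [DecidableEq n] [Fintype n]

/-- The matrix `I - D F`, where `D` is diagonal with entries `r` and `F` is the matrix of the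
function `f`. -/
def oneSubFunMatrix (r : n → ℝ) (f : n → n) : Matrix n n ℝ :=
  of fun i k ↦ (if i = k then 1 else 0) - if f i = k then r i else 0

/-- Here f is a single cycle without fixed points. A contributing σ has σ i ∈ {i, f i} for all i,
and one fixed point forces all others, so σ is the identity or f. -/
lemma permanent_oneSubFunMatrix_of_transitive [Nontrivial n] {f : n → n}
    (hf : ∀ y z, ∃ k, f^[k] y = z) (r : n → ℝ) :
    (oneSubFunMatrix r f).permanent = 1 + ∏ i, -r i := by
  have hsurj : Function.Surjective f := fun z ↦ by
    obtain ⟨k, hk⟩ := hf (f z) z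
    exact ⟨f^[k] z, by rw [← Function.iterate_succ_apply' f k z, Function.iterate_succ_apply, hk]⟩
  have hinj : Function.Injective f := Finite.injective_iff_surjective.2 hsurj
  have hne : ∀ i, f i ≠ i := fun i hi ↦ by
    obtain ⟨j, hj⟩ := exists_ne i
    obtain ⟨k, hk⟩ := hf i j
    exact hj (by rw [← hk, Function.iterate_fixed hi])
  let φ : Perm n := Equiv.ofBijective f ⟨hinj, hsurj⟩
  have hφ : φ ≠ 1 := fun h ↦ by
    obtain ⟨i⟩ : Nonempty n := inferInstance
    exact hne i (DFunLike.congr_fun h i)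
  rw [permanent_apply_row]
  have hzero : ∀ σ ∈ (univ : Finset (Perm n)), σ ≠ 1 ∧ σ ≠ φ →
      ∏ i, oneSubFunMatrix r f i (σ i) = 0 := by
    rintro σ - ⟨h₁, h₂⟩
    by_contra h
    have hmem : ∀ i, σ i = i ∨ σ i = f i := fun i ↦ by
      by_contra! hc
      exact h (prod_eq_zero (mem_univ i) (by simp [oneSubFunMatrix, hc.1.symm, hc.2.symm]))
    by_cases hfix : ∃ i, σ i = i
    · obtain ⟨i, hi⟩ := hfix
      -- Fixedness propagates backwards: if σ fixes f y and σ y = f y, injectivity gives σ y = y.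
      have hback : ∀ k y, f^[k] y = i → σ y = y := by
        intro k
        induction k with
        | zero => rintro y rfl; exact hi
        | succ k ih =>
          intro y hy
          rcases hmem y with h | h
          · exact h
          · have := ih (f y) hy
            rw [← h] at this
            exact σ.injective this
      exact h₁ (Equiv.ext fun y ↦ by obtain ⟨k, hk⟩ := hf y i; exact hback k y hk)
    · push Not at hfix
      exact h₂ (Equiv.ext fun y ↦ (hmem y).resolve_left (hfix y))
  rw [sum_eq_add 1 φ hφ.symm hzero (by simp) (by simp)]
  congr 1
  · exact prod_eq_one fun i _ ↦ by simp [oneSubFunMatrix, hne i]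
  · exact prod_congr rfl fun i _ ↦ by
      have h : φ i = f i := rfl
      simp [oneSubFunMatrix, h, (hne i).symm]

/-- Since all r_i ≤ 1, the product is at most that of two of them, and AM-GM applies. The lower
bound 0 is what lets the induction multiply by the estimate for the other block. -/
lemma permanent_oneSubFunMatrix_bounds_of_transitive [Nonempty n] {f : n → n}
    (hf : ∀ y z, ∃ k, f^[k] y = z) {r : n → ℝ} (hr₀ : ∀ i, 0 ≤ r i) (hr₁ : ∀ i, r i ≤ 1) :
    0 ≤ (oneSubFunMatrix r f).permanent ∧
      (oneSubFunMatrix r f).permanent ≤ floorGrowth ((∑ i, r i) / 2) := by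
  rcases subsingleton_or_nontrivial n with _ | _
  · obtain ⟨x⟩ : Nonempty n := inferInstance
    rw [permanent_eq_elem_of_subsingleton _ x]
    have h : oneSubFunMatrix r f x x = 1 - r x := by
      simp [oneSubFunMatrix, Subsingleton.elim (f x) x]
    rw [h]
    exact ⟨sub_nonneg.2 (hr₁ x), (sub_le_self _ (hr₀ x)).trans (one_le_floorGrowth _)⟩
  · rw [permanent_oneSubFunMatrix_of_transitive hf]
    have habs : |∏ i, -r i| = ∏ i, r i := by
      simp only [abs_prod, abs_neg, abs_of_nonneg (hr₀ _)]
    have hle : ∏ i, r i ≤ 1 := prod_le_one (fun i _ ↦ hr₀ i) fun i _ ↦ hr₁ i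
    obtain ⟨x, y, hxy⟩ := exists_pair_ne n
    have hy : y ∈ univ.erase x := mem_erase.2 ⟨hxy.symm, mem_univ y⟩
    have hprod : ∏ i, r i ≤ r x * r y := by
      rw [← mul_prod_erase _ _ (mem_univ x), ← mul_prod_erase _ _ hy]
      exact mul_le_mul_of_nonneg_left (mul_le_of_le_one_right (hr₀ y)
        (prod_le_one (fun i _ ↦ hr₀ i) fun i _ ↦ hr₁ i)) (hr₀ x)
    have hsum : r x + r y ≤ ∑ i, r i := by
      rw [← add_sum_erase _ _ (mem_univ x), ← add_sum_erase _ _ hy]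
      linarith [sum_nonneg fun i (_ : i ∈ (univ.erase x).erase y) ↦ hr₀ i]
    have h₁ := neg_abs_le (∏ i, -r i)
    have h₂ := le_abs_self (∏ i, -r i)
    refine ⟨by linarith, ?_⟩
    calc 1 + ∏ i, -r i ≤ 1 + ((r x + r y) / 2) ^ 2 := by nlinarith [sq_nonneg (r x - r y)]
      _ ≤ floorGrowth ((r x + r y) / 2) := one_add_sq_le_floorGrowth
          (by linarith [hr₀ x, hr₀ y]) (by linarith [hr₁ x, hr₁ y])
      _ ≤ _ := floorGrowth_mono (by linarith [hr₀ x, hr₀ y]) (by linarith)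

end Real

end Matrix

/-- Every self-map of a nonempty finite type has a nonempty invariant set on which it acts
transitively. -/
lemma exists_transitive_invariant_set {α : Type*} [Finite α] [Nonempty α] (f : α → α) :
    ∃ C : Set α, C.Nonempty ∧ (∀ x ∈ C, f x ∈ C) ∧ ∀ y ∈ C, ∀ z ∈ C, ∃ k, f^[k] y = z := by
  obtain ⟨x₀⟩ : Nonempty α := inferInstance
  obtain ⟨x, p, hp, hx⟩ : ∃ x p, 0 < p ∧ f^[p] x = x := by
    obtain ⟨a, b, hab, h⟩ := Finite.exists_ne_map_eq_of_infinite fun k : ℕ ↦ f^[k] x₀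
    wlog hlt : a < b generalizing a b
    · exact this b a hab.symm h.symm (by lia)
    · refine ⟨f^[a] x₀, b - a, by lia, ?_⟩
      rw [← Function.iterate_add_apply, Nat.sub_add_cancel hlt.le]
      exact h.symm
  refine ⟨Set.range fun k ↦ f^[k] x, ⟨x, 0, rfl⟩, ?_, ?_⟩
  · rintro _ ⟨k, rfl⟩
    exact ⟨k + 1, Function.iterate_succ_apply' f k x⟩
  · rintro _ ⟨k, rfl⟩ _ ⟨l, rfl⟩
    -- From f^k x, another pk - k steps complete k periods and return to x; l more reach f^l x.
    refine ⟨l + (p * k - k), ?_⟩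
    have hk : k ≤ p * k := Nat.le_mul_of_pos_left k hp
    dsimp only
    rw [← Function.iterate_add_apply, add_assoc, Nat.sub_add_cancel hk,
      Function.iterate_add_apply]
    congr 1
    rw [Function.iterate_mul]
    exact Function.iterate_fixed hx k

/-! ### The upper bound -/

namespace Matrix

open Finset

/-- For a nonnegative real matrix `A` with row sums at most one, `per (I - A)` is bounded in terms
of the sum of the entries of `A`. -/
theorem permanent_one_sub_le_floorGrowth {n : Type*} [DecidableEq n] [Fintype n]
    (A : Matrix n n ℝ) (hA₀ : ∀ i j, 0 ≤ A i j) (hA₁ : ∀ i, ∑ j, A i j ≤ 1) :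
    (1 - A).permanent ≤ floorGrowth ((∑ i, ∑ j, A i j) / 2) := by
  classical
  induction hc : Fintype.card n using Nat.strong_induction_on generalizing n with
  | _ c ih =>
  subst hc
  rcases isEmpty_or_nonempty n with _ | _
  · rw [permanent_isEmpty]
    exact one_le_floorGrowth _
  set r : n → ℝ := fun i ↦ ∑ j, A i j
  have hr₀ : ∀ i, 0 ≤ r i := fun i ↦ sum_nonneg fun j _ ↦ hA₀ i j
  have hfun : ∀ f : n → n,
      (oneSubFunMatrix r f).permanent ≤ floorGrowth ((∑ i, r i) / 2) := by
    intro f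
    obtain ⟨C, hC, hCf, hCt⟩ := exists_transitive_invariant_set f
    have hCne : Nonempty {i // i ∈ C} := hC.to_subtype
    rw [permanent_eq_mul_of_rows_zero (· ∈ C)]
    swap
    · intro i j hi hj
      have h₁ : i ≠ j := by rintro rfl; exact hj hi
      have h₂ : f i ≠ j := by rintro rfl; exact hj (hCf i hi)
      simp [oneSubFunMatrix, h₁, h₂]
    let g : {i // i ∈ C} → {i // i ∈ C} := fun i ↦ ⟨f i, hCf i i.2⟩
    have hg : ∀ k i, ((g^[k] i : {i // i ∈ C}) : n) = f^[k] i := by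
      intro k
      induction k with
      | zero => intro i; rfl
      | succ k ih => intro i; rw [Function.iterate_succ_apply, Function.iterate_succ_apply, ih]
    have hfst : (oneSubFunMatrix r f).submatrix (Subtype.val : {i // i ∈ C} → n) Subtype.val =
        oneSubFunMatrix (fun i : {i // i ∈ C} ↦ r i) g := by
      ext i j
      simp [oneSubFunMatrix, g, Subtype.ext_iff]
    -- Arrows from outside C into C are dropped, so a row of B may sum to 0 instead of r i; hence
    -- the induction is over row sums at most one, and monotonicity of `floorGrowth` absorbs the
    -- loss.
    let B : Matrix {i // i ∉ C} {i // i ∉ C} ℝ := of fun i j ↦ if f i = j then r i else 0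
    have hsnd : (oneSubFunMatrix r f).submatrix (Subtype.val : {i // i ∉ C} → n) Subtype.val =
        1 - B := by
      ext i j
      simp [oneSubFunMatrix, B, Subtype.ext_iff, one_apply]
    have hB₀ : ∀ i j, 0 ≤ B i j := fun i j ↦ by
      simp only [B, of_apply]
      split_ifs
      exacts [hr₀ _, le_rfl]
    have hBr : ∀ i, ∑ j, B i j ≤ r i := fun i ↦ by
      by_cases h : f i ∈ C
      · have : ∀ j : {i // i ∉ C}, f i ≠ j := fun j hj ↦ j.2 (hj ▸ h)
        simpa [B, this] using hr₀ i
      · have : ∀ j : {i // i ∉ C}, f i = j ↔ ⟨f i, h⟩ = j := fun j ↦ by simp [Subtype.ext_iff]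
        simp [B, this]
    have hcard : Fintype.card {i // i ∉ C} < Fintype.card n := by
      obtain ⟨x, hx⟩ := hC
      exact Fintype.card_subtype_lt (x := x) (by simpa using hx)
    have hper := ih _ hcard B hB₀ (fun i ↦ (hBr i).trans (hA₁ i)) rfl
    obtain ⟨hlow, hup⟩ := permanent_oneSubFunMatrix_bounds_of_transitive (f := g)
      (fun y z ↦ by
        obtain ⟨k, hk⟩ := hCt y y.2 z z.2
        exact ⟨k, Subtype.ext (by rw [hg, hk])⟩)
      (r := fun i ↦ r i) (fun i ↦ hr₀ i) (fun i ↦ hA₁ i)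
    rw [hfst, hsnd]
    have hs₀ : 0 ≤ ∑ i : {i // i ∈ C}, r i := sum_nonneg fun i _ ↦ hr₀ i
    have hs₁ : 0 ≤ ∑ i, ∑ j, B i j := sum_nonneg fun i _ ↦ sum_nonneg fun j _ ↦ hB₀ i j
    have hs₂ : ∑ i, ∑ j, B i j ≤ ∑ i : {i // i ∉ C}, r i := sum_le_sum fun i _ ↦ hBr i
    have hs₃ : ∑ i, r i = ∑ i : {i // i ∈ C}, r i + ∑ i : {i // i ∉ C}, r i :=
      (Fintype.sum_subtype_add_sum_subtype (· ∈ C) r).symm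
    calc _ ≤ floorGrowth ((∑ i : {i // i ∈ C}, r i) / 2) *
          floorGrowth ((∑ i, ∑ j, B i j) / 2) :=
          (mul_le_mul_of_nonneg_left hper hlow).trans
            (mul_le_mul_of_nonneg_right hup (zero_le_one.trans (one_le_floorGrowth _)))
      _ ≤ floorGrowth ((∑ i : {i // i ∈ C}, r i) / 2 + (∑ i, ∑ j, B i j) / 2) :=
          floorGrowth_mul_le (by linarith) (by linarith)
      _ ≤ _ := floorGrowth_mono (by linarith) (by linarith)
  obtain ⟨p, hp₀, hp₁, hpA⟩ : ∃ p : n → n → ℝ, (∀ i j, 0 ≤ p i j) ∧ (∀ i, ∑ j, p i j = 1) ∧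
      ∀ i j, p i j * r i = A i j := by
    -- A zero row has no normalization; any probability vector would do, as it gets multiplied by r
    -- i = 0.
    refine ⟨fun i j ↦ if r i = 0 then (if i = j then 1 else 0) else A i j / r i, ?_, ?_, ?_⟩
    · intro i j
      dsimp only
      split_ifs
      exacts [zero_le_one, le_rfl, div_nonneg (hA₀ i j) (hr₀ i)]
    · intro i
      by_cases h : r i = 0
      · simp [h]
      · simp only [h, if_false, ← sum_div]
        exact div_self h
    · intro i j
      by_cases h : r i = 0
      · have := (sum_eq_zero_iff_of_nonneg fun j _ ↦ hA₀ i j).1 h j (mem_univ j)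
        simp [h, this]
      · simp [h]
  have hsplit : 1 - A = of fun i k ↦ ∑ j, p i j * ((if i = k then 1 else 0) -
      if j = k then r i else 0) := by
    ext i k
    simp only [sub_apply, of_apply, mul_sub, sum_sub_distrib, ← sum_mul, hp₁, one_mul, one_apply]
    simp [hpA]
  rw [hsplit, permanent_of_rows_sum p fun i j k ↦ (if i = k then 1 else 0) -
      if j = k then r i else 0]
  calc _ ≤ ∑ f : n → n, (∏ i, p i (f i)) * floorGrowth ((∑ i, r i) / 2) :=
        sum_le_sum fun f _ ↦ mul_le_mul_of_nonneg_left (hfun f) (prod_nonneg fun i _ ↦ hp₀ _ _)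
    _ = (∏ i, ∑ j, p i j) * floorGrowth ((∑ i, r i) / 2) := by
        rw [← sum_mul, prod_univ_sum, Fintype.piFinset_univ]
    _ = _ := by simp [hp₁]

end Matrix

/-! ### The extremal block matrix -/

section SwapBlocks

open Finset Matrix

lemma swapBlocks_apply {n : ℕ} (c : ℕ → ℝ) (i j : Fin n) :
    swapBlocks n c i j =
      if (i : ℕ) / 2 = j / 2 ∧ (i : ℕ) ≠ j then c ((i : ℕ) / 2) else 0 := by
  have h : ∀ a b : ℕ, swapMatrix (Fin.ofNat 2 a) (Fin.ofNat 2 b) =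
      if a % 2 = b % 2 then 0 else 1 := by
    intro a b
    have ha : Fin.ofNat 2 a = if a % 2 = 0 then 0 else 1 := by
      ext; simp only [Fin.val_ofNat]; split_ifs <;> simp <;> lia
    have hb : Fin.ofNat 2 b = if b % 2 = 0 then 0 else 1 := by
      ext; simp only [Fin.val_ofNat]; split_ifs <;> simp <;> lia
    rw [ha, hb]
    rcases Nat.mod_two_eq_zero_or_one a with h₁ | h₁ <;>
      rcases Nat.mod_two_eq_zero_or_one b with h₂ | h₂ <;> simp [h₁, h₂, swapMatrix]
  simp only [swapBlocks, of_apply, h]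
  by_cases h₁ : (i : ℕ) / 2 = j / 2
  · by_cases h₂ : (i : ℕ) = j
    · simp [h₂]
    · have h₃ : ¬ (i : ℕ) % 2 = j % 2 := by lia
      simp [h₁, h₂, h₃]
  · simp [h₁]

lemma swapBlocks_symm {n : ℕ} (c : ℕ → ℝ) (i j : Fin n) :
    swapBlocks n c i j = swapBlocks n c j i := by
  simp only [swapBlocks_apply]
  by_cases h₁ : (i : ℕ) / 2 = j / 2
  · simp [h₁, eq_comm]
  · simp [h₁, Ne.symm h₁]

lemma swapBlocks_nonneg {n : ℕ} {c : ℕ → ℝ} (hc : ∀ k, 0 ≤ c k) (i j : Fin n) :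
    0 ≤ swapBlocks n c i j := by
  rw [swapBlocks_apply]
  split_ifs
  exacts [hc _, le_rfl]

lemma swapBlocks_row_sum_le {n : ℕ} {c : ℕ → ℝ} (hc : ∀ k, c k ≤ 1) (i : Fin n) :
    ∑ j, swapBlocks n c i j ≤ 1 := by
  calc ∑ j, swapBlocks n c i j
      ≤ ∑ j : Fin n, if (i : ℕ) / 2 = j / 2 ∧ (i : ℕ) ≠ j then (1 : ℝ) else 0 :=
        sum_le_sum fun j _ ↦ by
          rw [swapBlocks_apply]
          split_ifs
          exacts [hc _, le_rfl]
    _ = (#{j : Fin n | (i : ℕ) / 2 = j / 2 ∧ (i : ℕ) ≠ j} : ℝ) := by simp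
    _ ≤ 1 := by
        have h : #{j : Fin n | (i : ℕ) / 2 = j / 2 ∧ (i : ℕ) ≠ j} ≤ 1 := by
          refine card_le_one.2 fun a ha b hb ↦ ?_
          simp only [mem_filter, mem_univ, true_and] at ha hb
          ext
          lia
        exact_mod_cast h

lemma isDoublySubstochastic_swapBlocks (n : ℕ) {c : ℕ → ℝ} (hc₀ : ∀ k, 0 ≤ c k)
    (hc₁ : ∀ k, c k ≤ 1) : IsDoublySubstochastic (swapBlocks n c) where
  nonneg := swapBlocks_nonneg hc₀
  row_sum_le := swapBlocks_row_sum_le hc₁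
  col_sum_le j := by
    simp only [swapBlocks_symm c _ j]
    exact swapBlocks_row_sum_le hc₁ j

/-- Splitting off the last block drives the inductions for the permanent and the entry sum. -/
lemma swapBlocks_submatrix_add_two (m : ℕ) (c : ℕ → ℝ) :
    (swapBlocks (2 * m + 2) c).submatrix finSumFinEquiv finSumFinEquiv =
      fromBlocks (swapBlocks (2 * m) c) 0 0 !![0, c m; c m, 0] := by
  have h₀ : ∀ i : Fin (2 * m), (i : ℕ) / 2 ≠ m := fun i ↦ by lia
  have h₁ : (2 * m + 1) / 2 = m := by lia
  ext (i | i) (j | j)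
  · simp [swapBlocks_apply]
  · fin_cases j <;> simp [swapBlocks_apply, h₀, h₁]
  · fin_cases i <;> simp [swapBlocks_apply, (h₀ _).symm, h₁]
  · fin_cases i <;> fin_cases j <;> simp [swapBlocks_apply, h₁]

lemma swapBlocks_submatrix_add_one (m : ℕ) (c : ℕ → ℝ) :
    (swapBlocks (2 * m + 1) c).submatrix finSumFinEquiv finSumFinEquiv =
      fromBlocks (swapBlocks (2 * m) c) 0 0 0 := by
  have h₀ : ∀ i : Fin (2 * m), (i : ℕ) / 2 ≠ m := fun i ↦ by lia
  ext (i | i) (j | j)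
  · simp [swapBlocks_apply]
  · fin_cases j; simp [swapBlocks_apply, h₀]
  · fin_cases i; simp [swapBlocks_apply, (h₀ _).symm]
  · fin_cases i; fin_cases j; simp [swapBlocks_apply]

lemma Matrix.permanent_fin_two {R : Type*} [CommSemiring R] (M : Matrix (Fin 2) (Fin 2) R) :
    M.permanent = M 0 0 * M 1 1 + M 0 1 * M 1 0 := by
  have h : (univ : Finset (Equiv.Perm (Fin 2))) = {1, Equiv.swap 0 1} := by decide
  rw [permanent_apply_row, h, sum_pair (by decide)]
  simp

lemma Matrix.permanent_one_sub_eq_mul {m n k : Type*} [DecidableEq m] [Fintype m] [DecidableEq n]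
    [Fintype n] [DecidableEq k] [Fintype k] (e : m ⊕ n ≃ k) {A : Matrix k k ℝ} {B : Matrix m m ℝ}
    {D : Matrix n n ℝ} (h : A.submatrix e e = fromBlocks B 0 0 D) :
    (1 - A).permanent = (1 - B).permanent * (1 - D).permanent := by
  rw [← permanent_fromBlocks_zero₂₁ _ 0, ← permanent_submatrix_equiv_self e]
  congr 1
  have h' : (1 - A).submatrix e e = 1 - A.submatrix e e := by
    ext i j
    simp [one_apply]
  rw [h', h]
  ext (i | i) (j | j) <;> simp [one_apply]

lemma permanent_one_sub_swapBlocks_two_mul (m : ℕ) (c : ℕ → ℝ) :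
    (1 - swapBlocks (2 * m) c).permanent = ∏ k ∈ range m, (1 + c k ^ 2) := by
  induction m with
  | zero =>
    rw [permanent_eq_one_of_card_eq_zero (by simp)]
    simp
  | succ m ih =>
    rw [prod_range_succ, ← ih]
    refine (permanent_one_sub_eq_mul _ (swapBlocks_submatrix_add_two m c)).trans ?_
    rw [permanent_fin_two]
    congr 1
    simp [sq]

lemma permanent_one_sub_swapBlocks (n : ℕ) (c : ℕ → ℝ) :
    (1 - swapBlocks n c).permanent = ∏ k ∈ range (n / 2), (1 + c k ^ 2) := by
  obtain ⟨m, rfl | rfl⟩ := n.even_or_odd'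
  · rw [permanent_one_sub_swapBlocks_two_mul, Nat.mul_div_cancel_left m two_pos]
  · rw [permanent_one_sub_eq_mul _ (swapBlocks_submatrix_add_one m c),
      permanent_one_sub_swapBlocks_two_mul, sub_zero, permanent_one, mul_one,
      show (2 * m + 1) / 2 = m by lia]

lemma entrySum_eq_add {n : ℕ} {m k : Type*} [Fintype m] [Fintype k] (e : m ⊕ k ≃ Fin n)
    {A : Matrix (Fin n) (Fin n) ℝ} {B : Matrix m m ℝ} {D : Matrix k k ℝ}
    (h : A.submatrix e e = fromBlocks B 0 0 D) :
    entrySum A = ∑ i, ∑ j, B i j + ∑ i, ∑ j, D i j := by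
  have hA : ∀ i j, A (e i) (e j) = fromBlocks B 0 0 D i j := fun i j ↦ by rw [← h]; rfl
  simp only [entrySum, ← e.sum_comp, hA]
  simp [Fintype.sum_sum_type]

lemma entrySum_swapBlocks_two_mul (m : ℕ) (c : ℕ → ℝ) :
    entrySum (swapBlocks (2 * m) c) = 2 * ∑ k ∈ range m, c k := by
  induction m with
  | zero => simp [entrySum]
  | succ m ih =>
    rw [sum_range_succ, mul_add (2 : ℝ), ← ih]
    refine (entrySum_eq_add _ (swapBlocks_submatrix_add_two m c)).trans ?_
    congr 1
    simp [two_mul]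

lemma entrySum_swapBlocks (n : ℕ) (c : ℕ → ℝ) :
    entrySum (swapBlocks n c) = 2 * ∑ k ∈ range (n / 2), c k := by
  obtain ⟨m, rfl | rfl⟩ := n.even_or_odd'
  · rw [entrySum_swapBlocks_two_mul, Nat.mul_div_cancel_left m two_pos]
  · rw [entrySum_eq_add _ (swapBlocks_submatrix_add_one m c), show (2 * m + 1) / 2 = m by lia,
      ← entrySum_swapBlocks_two_mul]
    simp [entrySum]

end SwapBlocks

/-! ### The maximum -/

theorem theorem3p1 (n : ℕ) (s : ℝ) (hs0 : 0 ≤ s) (hsn : s ≤ (n : ℝ))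
    (hn : Even n ∨ (Odd n ∧ s ≤ (n : ℝ) - 1))
    (e : ℕ) (he : IsGreatest {k : ℤ | Even k ∧ (k : ℝ) ≤ s} (e : ℤ)) :
    IsGreatest ((fun A : Matrix (Fin n) (Fin n) ℝ => (1 - A).permanent) '' omegaSet n s)
        ((2 : ℝ) ^ (e / 2) * (1 + ((s - (e : ℝ)) / 2) ^ 2)) ∧
      extremalMatrix n s e ∈ omegaSet n s ∧
      (1 - extremalMatrix n s e).permanent =
        (2 : ℝ) ^ (e / 2) * (1 + ((s - (e : ℝ)) / 2) ^ 2) := by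
  obtain ⟨⟨heven, hes⟩, hmax⟩ := he
  obtain ⟨q, rfl⟩ : ∃ q, e = 2 * q := by
    rw [Int.even_coe_nat] at heven
    exact heven.exists_two_nsmul e |>.imp fun q hq ↦ by simpa using hq
  have hqs : 2 * (q : ℝ) ≤ s := by simpa using hes
  have hsq : s < 2 * q + 2 := by
    by_contra! h
    have : (2 * (q : ℤ) + 2) ∈ {k : ℤ | Even k ∧ (k : ℝ) ≤ s} :=
      ⟨⟨q + 1, by ring⟩, by push_cast; exact h⟩
    have := hmax this
    push_cast at this
    lia
  have hq2 : 2 * q / 2 = q := Nat.mul_div_cancel_left q two_pos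
  set t : ℝ := (s - (2 * q : ℕ)) / 2 with ht
  have hts : s = 2 * (q + t) := by rw [ht]; push_cast; ring
  have ht₀ : 0 ≤ t := by linarith
  have ht₁ : t < 1 := by linarith
  have hgrowth : floorGrowth (s / 2) = 2 ^ q * (1 + t ^ 2) := by
    rw [floorGrowth_eq (m := q) (by linarith) (by linarith), hts]
    ring
  set c : ℕ → ℝ := fun k ↦ if k < q then 1 else if k = q then t else 0 with hc
  have hext : extremalMatrix n s (2 * q) = swapBlocks n c := by rw [extremalMatrix, hq2]
  -- The parity assumption enters here: s fits into the n / 2 complete blocks.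
  have hsm : s ≤ 2 * (n / 2 : ℕ) := by
    rcases hn with h | ⟨h, hs⟩
    · have : (2 * (n / 2 : ℕ) : ℝ) = n := by exact_mod_cast Nat.two_mul_div_two_of_even h
      linarith
    · have : (2 * (n / 2 : ℕ) + 1 : ℝ) = n := by
        exact_mod_cast Nat.two_mul_div_two_add_one_of_odd h
      linarith
  -- Either the unit blocks fill all available room and no remainder is left, or there is a block
  -- for t.
  have hcases : (q = n / 2 ∧ t = 0) ∨ ∃ d, n / 2 = q + 1 + d := by
    have hle : q ≤ n / 2 := by
      have : (q : ℝ) ≤ (n / 2 : ℕ) := by linarith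
      exact_mod_cast this
    rcases hle.eq_or_lt with h | h
    · refine .inl ⟨h, le_antisymm ?_ ht₀⟩
      rw [← h] at hsm
      linarith
    · obtain ⟨d, hd⟩ := Nat.exists_eq_add_of_le (Nat.succ_le_of_lt h)
      exact .inr ⟨d, hd⟩
  have hclt : ∀ k ∈ Finset.range q, c k = 1 := fun k hk ↦ by simp [hc, Finset.mem_range.1 hk]
  have hcq : c q = t := by simp [hc]
  have hcgt : ∀ k, c (q + 1 + k) = 0 := fun k ↦ by
    simp [hc, show ¬ q + 1 + k < q by lia, show ¬ q + 1 + k = q by lia]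
  have hprod : ∏ k ∈ Finset.range (n / 2), (1 + c k ^ 2) = 2 ^ q * (1 + t ^ 2) := by
    have h : ∏ k ∈ Finset.range q, (1 + c k ^ 2) = 2 ^ q := by
      rw [Finset.prod_congr rfl fun k hk ↦ by rw [hclt k hk]]
      norm_num
    rcases hcases with ⟨h₁, h₂⟩ | ⟨d, hd⟩
    · simp [← h₁, h, h₂]
    · rw [hd, Finset.prod_range_add, Finset.prod_range_succ, h, hcq]
      simp [hcgt]
  have hsum : ∑ k ∈ Finset.range (n / 2), c k = q + t := by
    have h : ∑ k ∈ Finset.range q, c k = q := by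
      rw [Finset.sum_congr rfl hclt]
      simp
    rcases hcases with ⟨h₁, h₂⟩ | ⟨d, hd⟩
    · simp [← h₁, h, h₂]
    · rw [hd, Finset.sum_range_add, Finset.sum_range_succ, h, hcq]
      simp [hcgt]
  have hmem : extremalMatrix n s (2 * q) ∈ omegaSet n s := by
    rw [hext]
    refine ⟨isDoublySubstochastic_swapBlocks n (fun k ↦ ?_) (fun k ↦ ?_), ?_⟩
    · simp only [hc]
      split_ifs <;> linarith
    · simp only [hc]
      split_ifs <;> linarith
    · rw [entrySum_swapBlocks, hsum, hts]
  have hval : (1 - extremalMatrix n s (2 * q)).permanent = 2 ^ (2 * q / 2) * (1 + t ^ 2) := by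
    rw [hext, permanent_one_sub_swapBlocks, hprod, hq2]
  refine ⟨⟨⟨_, hmem, hval⟩, ?_⟩, hmem, hval⟩
  rintro _ ⟨A, ⟨hA, hAs⟩, rfl⟩
  have h := A.permanent_one_sub_le_floorGrowth hA.nonneg hA.row_sum_le
  rwa [show ∑ i, ∑ j, A i j = s from hAs, hgrowth, ← hq2] at h
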